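/- Let $L$ be a Latin square of order $n$, that is, an $n\times n$ array $(L_{ij})$ with entries from a set $A$ of $n$ elements in which every element of $A$ appears exactly once in each row and exactly once in each column. For $S\subseteq A$ let $\Gamma(L;S)$ be the simple graph on the vertex set $[n]$ in which two distinct vertices $i,j$ are joined if and only if $L_{ij}\in S$ or $L_{ji}\in S$. For $p\in[0,1]$ let $\mathcal{G}(L,p)$ be the distribution of $\Gamma(L;S)$ when every element of $A$ is put into $S$ independently with probability $p$. Let $\varepsilon>0$, let $(L_k)_{k\in\mathbb{N}}$ be any sequence of Latin squares, $L_k$ of order $n_k$, with $n_k\to\infty$, let $p_k\in[0,1]$, and let $\Gamma_k\in\mathcal{G}(L_k,p_k)$. (i) If $p_k\ge\sqrt{(26+\varepsilon)\frac{\log n_k}{n_k}}$ for all sufficiently large $k$, then with high probability the diameter of $\Gamma_k$ is at most $2$; that is, $\Pr(\operatorname{diam}\Gamma_k\le 2)\to 1$ as $k\to\infty$. (ii) If $p_k\le\sqrt{\left(\frac14-\varepsilon\right)\frac{\log n_k}{n_k}}$ for all sufficiently large $k$ (where $\sqrt{x}$ is read as $0$ if $x<0$), then with high probability the diameter of $\Gamma_k$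 is greater than $2$; that is, $\Pr(\operatorname{diam}\Gamma_k> 2)\to 1$ as $k\to\infty$. Here the diameter of a disconnected graph is $\infty$. -/

import Mathlib

open MeasureTheory

/-- A Latin square of order `n` with entries in the `n`-element set `A`: an `n × n` array in which
every element of `A` appears exactly once in each row and exactly once in each column. -/
structure LatinSquare (n : ℕ) (A : Type*) [Fintype A] where
  /-- The entry in row `i` and column `j`. -/
  entry : Fin n → Fin n → A
  card_entries : Fintype.card A = n
  row_existsUnique : ∀ (i : Fin n) (a : A), ∃! j : Fin n, entry i j = a
  col_existsUnique : ∀ (j : Fin n) (a : A), ∃! i : Fin n, entry i j = a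

namespace LatinSquare

variable {n : ℕ} {A : Type*} [Fintype A]

/-- The Latin square graph `Γ(L; S)`: distinct vertices `i`, `j` are joined if and only if
`L i j ∈ S` or `L j i ∈ S` (loops are ignored). -/
def graph (L : LatinSquare n A) (S : Set A) : SimpleGraph (Fin n) where
  Adj i j := i ≠ j ∧ (L.entry i j ∈ S ∨ L.entry j i ∈ S)
  symm := ⟨fun _ _ h => ⟨h.1.symm, h.2.symm⟩⟩
  loopless := ⟨fun _ h => h.1 rfl⟩

/-- The model `𝒢(L, p)`: the law of `Γ(L; S)`, where every element of the entry set belongs to the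
random set `S` independently with probability `p`. -/
noncomputable def randomGraph (L : LatinSquare n A) (p : unitInterval) :
    Measure (SimpleGraph (Fin n)) :=
  (ProbabilityTheory.setBernoulli (Set.univ : Set A) p).map L.graph

theorem measurable_graph (L : LatinSquare n A) : Measurable L.graph :=
  Measurable.of_discrete

instance isProbabilityMeasure_randomGraph (L : LatinSquare n A) (p : unitInterval) :
    IsProbabilityMeasure (L.randomGraph p) :=
  Measure.isProbabilityMeasure_map L.measurable_graph.aemeasurable

theorem measurableSet_simpleGraph (E : Set (SimpleGraph (Fin n))) : MeasurableSet E :=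
  ⟨SimpleGraph.Adj '' E, MeasurableSet.of_discrete,
    Set.preimage_image_eq E fun _ _ h => SimpleGraph.ext h⟩

theorem randomGraph_apply (L : LatinSquare n A) (p : unitInterval)
    (E : Set (SimpleGraph (Fin n))) :
    L.randomGraph p E =
      ProbabilityTheory.setBernoulli (Set.univ : Set A) p {S | L.graph S ∈ E} :=
  Measure.map_apply L.measurable_graph (measurableSet_simpleGraph E)

end LatinSquare

/-! Upper threshold. For `i ≠ j`, every column `k` whose pair `{L i k, L j k}` lies in `S` puts `i`
and `j` within distance two. A pair meets at most three of these pairs, itself included, so at least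
`n / 3` of them are pairwise disjoint, hence independent. All fail with probability at most `exp
(-p² n / 3)`, and a union bound over the `n²` pairs of vertices finishes
(`setBernoulli_not_joined_le`, `one_sub_le_randomGraph_ediam_le_two`).

Lower threshold. Fix a vertex `o` and apply the second moment method to the number of `j` at
distance more than two from `o`. Paths of length two from `o` to `j` come from at most `4 n` pairs
of entries, since each edge can be read in two ways, plus boundedly many single entries for most
`j`. A Harris-type inequality (`prod_le_setBernoulli_avoiding`) bounds the probability of no such
path below by about `exp (-4 n p²) ≥ n ^ (-1 + 4 ε)`, so the mean diverges. For two vertices `i`,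
`j`, an upper bound of Janson type (`setBernoulli_avoiding_le`) shows near-independence unless their
families of pairs overlap in more than `M` places. Double counting leaves at most `64 n / M` bad `j`
for each `i`, and `M ≈ n ^ (1 - 2 ε)` makes both error terms vanish. -/

namespace LatinSquare

/-! ### Random subsets: conditioning and avoidance probabilities. -/

section Bernoulli

open ProbabilityTheory

variable {A : Type*}

/-- The family of sets that contain no member of `F`. -/
def avoiding (F : Finset (Finset A)) : Set (Set A) :=
  {S | ∀ f ∈ F, ¬ (f : Set A) ⊆ S}

theorem avoiding_anti {F G : Finset (Finset A)} (h : F ⊆ G) : avoiding G ⊆ avoiding F :=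
  fun _ hS f hf => hS f (h hf)

theorem avoiding_union [DecidableEq A] (F G : Finset (Finset A)) :
    avoiding (F ∪ G) = avoiding F ∩ avoiding G := by
  ext S
  simp only [avoiding, Finset.mem_union, Set.mem_inter_iff, Set.mem_ofPred_eq]
  grind

variable [Fintype A]

/-- The odds `p / (1 - p)` of one element, multiplied out so that `p = 1` is covered. -/
theorem setBernoulli_mul_insert (p : unitInterval) {a : A} {S : Set A} (ha : a ∉ S) :
    (1 - p : ℝ) * (setBernoulli (Set.univ : Set A) p).real {insert a S} =
      p * (setBernoulli (Set.univ : Set A) p).real {S} := by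
  have hfin : (Set.univ : Set A).Finite := Set.toFinite _
  rw [setBernoulli_real_singleton p (Set.subset_univ _) hfin,
    setBernoulli_real_singleton p (Set.subset_univ _) hfin,
    Set.ncard_insert_of_notMem ha (Set.toFinite _)]
  have : (Set.univ \ S) = insert a (Set.univ \ insert a S) := by
    ext x
    by_cases hx : x = a
    · subst hx; simpa using ha
    · simp [hx]
  rw [this, Set.ncard_insert_of_notMem (by simp) (Set.toFinite _)]
  ring

/-- An event that ignores `a` is independent of `a ∈ S`: pair each `S` without `a` with `insert a
S`. -/
theorem setBernoulli_inter_mem_of_invariant (p : unitInterval) (a : A) (E : Set (Set A))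
    (hE : ∀ S, insert a S ∈ E ↔ S ∈ E) :
    (setBernoulli (Set.univ : Set A) p).real {S | a ∈ S ∧ S ∈ E} =
      p * (setBernoulli (Set.univ : Set A) p).real E := by
  classical
  set μ := setBernoulli (Set.univ : Set A) p
  have key : (1 - p : ℝ) * μ.real {S | a ∈ S ∧ S ∈ E} = p * μ.real {S | a ∉ S ∧ S ∈ E} := by
    have h1 : {S | a ∈ S ∧ S ∈ E} =
        ((Finset.univ.filter fun S : Set A => a ∈ S ∧ S ∈ E : Finset (Set A)) : Set (Set A)) := by
      ext; simp
    have h2 : {S | a ∉ S ∧ S ∈ E} =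
        ((Finset.univ.filter fun S : Set A => a ∉ S ∧ S ∈ E : Finset (Set A)) : Set (Set A)) := by
      ext; simp
    rw [h1, h2, ← sum_measureReal_singleton, ← sum_measureReal_singleton,
      Finset.mul_sum, Finset.mul_sum]
    refine (Finset.sum_bij (fun S _ => insert a S) ?_ ?_ ?_ ?_).symm
    · intro S hS
      simp only [Finset.mem_filter, Finset.mem_univ, true_and] at hS ⊢
      exact ⟨Set.mem_insert _ _, (hE S).2 hS.2⟩
    · intro S hS T hT h
      simp only [Finset.mem_filter, Finset.mem_univ, true_and] at hS hT
      rw [← Set.insert_sdiff_self_of_notMem hS.1, h, Set.insert_sdiff_self_of_notMem hT.1]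
    · intro T hT
      simp only [Finset.mem_filter, Finset.mem_univ, true_and] at hT
      have h : insert a (T \ {a}) = T := by
        rw [Set.insert_sdiff_singleton, Set.insert_eq_of_mem hT.1]
      refine ⟨T \ {a}, ?_, h⟩
      simp only [Finset.mem_filter, Finset.mem_univ, true_and]
      refine ⟨by simp, ?_⟩
      rw [← hE, h]
      exact hT.2
    · intro S hS
      simp only [Finset.mem_filter, Finset.mem_univ, true_and] at hS
      exact (setBernoulli_mul_insert p hS.1).symm
  have hsplit : μ.real E = μ.real {S | a ∈ S ∧ S ∈ E} + μ.real {S | a ∉ S ∧ S ∈ E} := by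
    rw [← measureReal_union]
    · congr 1; ext S; simp only [Set.mem_union, Set.mem_ofPred_eq]; tauto
    · rw [Set.disjoint_left]; rintro S h1 h2; exact h2.1 h1.1
    · exact MeasurableSet.of_discrete
  rw [hsplit]
  linear_combination key

/-- Conditioned on containing `T`, the random set is distributed as `S ∪ T`; elements of `T` are
exposed one at a time. -/
theorem setBernoulli_superset (p : unitInterval) (T : Finset A) (E : Set (Set A)) :
    (setBernoulli (Set.univ : Set A) p).real {S | (T : Set A) ⊆ S ∧ S ∈ E} =
      (p : ℝ) ^ T.card * (setBernoulli (Set.univ : Set A) p).real {S | S ∪ T ∈ E} := by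
  classical
  induction T using Finset.induction_on generalizing E with
  | empty => simp
  | insert a T ha ih =>
    have h1 : {S | ((insert a T : Finset A) : Set A) ⊆ S ∧ S ∈ E} =
        {S | (T : Set A) ⊆ S ∧ S ∈ {S | a ∈ S ∧ S ∈ E}} := by
      ext S; simp only [Finset.coe_insert, Set.insert_subset_iff, Set.mem_ofPred_eq]; tauto
    have h2 : {S | S ∪ (T : Set A) ∈ {S | a ∈ S ∧ S ∈ E}} =
        {S | a ∈ S ∧ S ∈ {S | S ∪ ((insert a T : Finset A) : Set A) ∈ E}} := by
      ext S
      simp only [Set.mem_ofPred_eq, Finset.coe_insert, Set.mem_union, Finset.mem_coe, ha, or_false]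
      refine and_congr_right fun h => ?_
      rw [Set.union_insert, Set.insert_eq_of_mem (Set.mem_union_left _ h)]
    rw [h1, ih, h2, setBernoulli_inter_mem_of_invariant, Finset.card_insert_of_notMem ha]
    · ring
    · intro S
      simp [Set.insert_union, Set.union_insert]

theorem setBernoulli_disjoint (p : unitInterval) (T : Finset A) (E : Set (Set A)) :
    (setBernoulli (Set.univ : Set A) p).real {S | Disjoint S (T : Set A) ∧ S ∈ E} =
      (1 - p : ℝ) ^ T.card * (setBernoulli (Set.univ : Set A) p).real {S | S \ T ∈ E} := by
  classical
  induction T using Finset.induction_on generalizing E with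
  | empty => simp
  | insert a T ha ih =>
    have h1 : {S | Disjoint S ((insert a T : Finset A) : Set A) ∧ S ∈ E} =
        {S | Disjoint S (T : Set A) ∧ S ∈ {S | a ∉ S ∧ S ∈ E}} := by
      ext S
      simp only [Finset.coe_insert, Set.disjoint_insert_right, Set.mem_ofPred_eq]; tauto
    -- Written as a difference so that the independence lemma, stated for `a ∈ S`, applies.
    have h2 : {S | S \ (T : Set A) ∈ {S | a ∉ S ∧ S ∈ E}} =
        {S | S \ ((insert a T : Finset A) : Set A) ∈ E} \
          {S | a ∈ S ∧ S ∈ {S | S \ ((insert a T : Finset A) : Set A) ∈ E}} := by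
      ext S
      simp only [Set.mem_ofPred_eq, Finset.coe_insert, Set.mem_sdiff, Finset.mem_coe, ha,
        not_false_eq_true, and_true]
      by_cases h : a ∈ S
      · simp [h]
      · have : S \ insert a (T : Set A) = S \ T := by
          ext x; simp only [Set.mem_sdiff, Set.mem_insert_iff]; grind
        simp [h, this]
    rw [h1, ih, h2, measureReal_sdiff (fun S h => h.2) MeasurableSet.of_discrete,
      setBernoulli_inter_mem_of_invariant, Finset.card_insert_of_notMem ha]
    · ring
    · intro S
      have : insert a S \ insert a (T : Set A) = S \ insert a (T : Set A) := by
        ext x; simp only [Set.mem_sdiff, Set.mem_insert_iff]; grind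
      simp [this]

theorem avoiding_insert_real [DecidableEq A] (p : unitInterval) (e : Finset A)
    (F : Finset (Finset A)) :
    (setBernoulli (Set.univ : Set A) p).real (avoiding (insert e F)) =
      (setBernoulli (Set.univ : Set A) p).real (avoiding F) -
        (p : ℝ) ^ e.card *
          (setBernoulli (Set.univ : Set A) p).real {S | S ∪ e ∈ avoiding F} := by
  have : avoiding (insert e F) = avoiding F \ {S | (e : Set A) ⊆ S ∧ S ∈ avoiding F} := by
    ext S
    simp only [avoiding, Finset.mem_insert, forall_eq_or_imp, Set.mem_ofPred_eq, Set.mem_sdiff]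
    tauto
  rw [this, measureReal_sdiff (fun S h => h.2) MeasurableSet.of_discrete, setBernoulli_superset]

/-- Positive correlation of decreasing events: forcing `e` into `S` only makes avoiding `F` harder,
so each new member costs at most a factor `1 - p ^ e.card`. -/
theorem prod_le_setBernoulli_avoiding (p : unitInterval) (F : Finset (Finset A)) :
    ∏ f ∈ F, (1 - (p : ℝ) ^ f.card) ≤ (setBernoulli (Set.univ : Set A) p).real (avoiding F) := by
  classical
  induction F using Finset.induction_on with
  | empty => simp [avoiding]
  | insert e F he ih =>
    rw [avoiding_insert_real, Finset.prod_insert he]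
    have h0 : (0 : ℝ) ≤ (p : ℝ) ^ e.card := pow_nonneg p.2.1 _
    have h1 : (p : ℝ) ^ e.card ≤ 1 := pow_le_one₀ p.2.1 p.2.2
    have h2 : (setBernoulli (Set.univ : Set A) p).real {S | S ∪ e ∈ avoiding F} ≤
        (setBernoulli (Set.univ : Set A) p).real (avoiding F) :=
      measureReal_mono fun S hS f hf h => hS f hf (h.trans Set.subset_union_left)
    nlinarith [mul_le_mul_of_nonneg_left ih (sub_nonneg.2 h1), mul_le_mul_of_nonneg_left h2 h0]

/-- A near-converse to the product bound when each pair meets few others. If `N` collects the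
elements outside `e` of pairs meeting `e`, then deleting `N` keeps `F` avoided even after `e` is
added. Emptying `N` costs at most `(1 - p) ^ D`; for disjoint pairs `D = 0` and nothing is lost. -/
theorem setBernoulli_avoiding_le [DecidableEq A] (p : unitInterval) (D : ℕ)
    (F : Finset (Finset A)) (hF : ∀ f ∈ F, f.card = 2)
    (hD : ∀ e ∈ F, ((F.filter fun f => ¬ Disjoint f e).biUnion id \ e).card ≤ D) :
    (setBernoulli (Set.univ : Set A) p).real (avoiding F) ≤
      (1 - (p : ℝ) ^ 2 * (1 - p : ℝ) ^ D) ^ F.card := by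
  have hp0 : (0 : ℝ) ≤ p := p.2.1
  have hp1 : (0 : ℝ) ≤ 1 - p := sub_nonneg.2 p.2.2
  have hp1' : (1 - p : ℝ) ≤ 1 := by linarith
  have hx : (p : ℝ) ^ 2 * (1 - p : ℝ) ^ D ≤ 1 :=
    mul_le_one₀ (pow_le_one₀ hp0 p.2.2) (pow_nonneg hp1 _) (pow_le_one₀ hp1 hp1')
  induction F using Finset.induction_on with
  | empty => simp [avoiding]
  | insert e F he ih =>
    have ih' := ih (fun f hf => hF f (Finset.mem_insert_of_mem hf)) fun f hf =>
      (Finset.card_le_card (Finset.sdiff_subset_sdiff (Finset.biUnion_subset_biUnion_of_subset_left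
        _ (Finset.filter_subset_filter _ (Finset.subset_insert _ _))) le_rfl)).trans
        (hD f (Finset.mem_insert_of_mem hf))
    set N := ((insert e F).filter fun f => ¬ Disjoint f e).biUnion id \ e with hN
    have hNe : N.card ≤ D := hD e (Finset.mem_insert_self _ _)
    have hsub : avoiding F ⊆ {S : Set A | S \ (N : Set A) ∈ {S : Set A | S ∪ (e : Set A) ∈ avoiding F}} := by
      intro S hS f hf hfS
      by_cases hd : Disjoint f e
      · refine hS f hf fun x hx => ?_
        rcases hfS hx with h | h
        · exact h.1
        · exact absurd h (Finset.disjoint_left.1 hd hx)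
      · have hfe : f ⊆ e := by
          intro x hx
          rcases hfS hx with h | h
          · by_contra hxe
            refine h.2 ?_
            rw [hN, Finset.mem_coe, Finset.mem_sdiff, Finset.mem_biUnion]
            exact ⟨⟨f, Finset.mem_filter.2 ⟨Finset.mem_insert_of_mem hf, hd⟩, hx⟩, hxe⟩
          · exact h
        have := Finset.eq_of_subset_of_card_le hfe
          (by rw [hF f (Finset.mem_insert_of_mem hf), hF e (Finset.mem_insert_self _ _)])
        exact he (this ▸ hf)
    have hlow : (1 - p : ℝ) ^ D * (setBernoulli (Set.univ : Set A) p).real (avoiding F) ≤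
        (setBernoulli (Set.univ : Set A) p).real {S | S ∪ e ∈ avoiding F} := by
      calc _ ≤ (1 - p : ℝ) ^ N.card *
            (setBernoulli (Set.univ : Set A) p).real {S : Set A | S \ (N : Set A) ∈ {S : Set A | S ∪ (e : Set A) ∈ avoiding F}} :=
            mul_le_mul (pow_le_pow_of_le_one hp1 hp1' hNe) (measureReal_mono hsub)
              measureReal_nonneg (pow_nonneg hp1 _)
        _ = (setBernoulli (Set.univ : Set A) p).real
              {S : Set A | Disjoint S (N : Set A) ∧ S ∈ {S : Set A | S ∪ (e : Set A) ∈ avoiding F}} :=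
            (setBernoulli_disjoint p N _).symm
        _ ≤ _ := measureReal_mono fun S h => h.2
    rw [avoiding_insert_real, Finset.card_insert_of_notMem he, pow_succ,
      hF e (Finset.mem_insert_self _ _)]
    have h3 := mul_le_mul_of_nonneg_left hlow (sq_nonneg (p : ℝ))
    have h4 := mul_le_mul_of_nonneg_right ih' (sub_nonneg.2 hx)
    linarith

end Bernoulli

/-! ### Distance at most two, and the upper threshold. -/

theorem ediam_le_two_iff {V : Type*} (G : SimpleGraph V) :
    G.ediam ≤ 2 ↔ ∀ u v, u = v ∨ G.Adj u v ∨ ∃ w, G.Adj u w ∧ G.Adj w v := by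
  rw [SimpleGraph.ediam_le_iff]
  refine forall₂_congr fun u v => ⟨fun h => ?_, ?_⟩
  · have hne : G.edist u v ≠ ⊤ := ne_top_of_le_ne_top (by decide) h
    obtain ⟨w, hw⟩ := SimpleGraph.exists_walk_of_edist_ne_top hne
    rw [← hw] at h
    have h2 : w.length ≤ 2 := by exact_mod_cast h
    match w, h2 with
    | .nil, _ => exact Or.inl rfl
    | .cons a .nil, _ => exact Or.inr (Or.inl a)
    | .cons a (.cons b .nil), _ => exact Or.inr (Or.inr ⟨_, a, b⟩)
    | .cons a (.cons b (.cons c q)), h => simp at h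
  · rintro (rfl | h | ⟨w, h1, h2⟩)
    · simp
    · exact (SimpleGraph.edist_le (.cons h .nil)).trans (by norm_num)
    · exact (SimpleGraph.edist_le (.cons h1 (.cons h2 .nil))).trans (by norm_num)

section Joined

variable {n : ℕ} {A : Type*} [Fintype A] (L : LatinSquare n A)

theorem row_injective {i j j' : Fin n} (h : L.entry i j = L.entry i j') : j = j' :=
  (L.row_existsUnique i (L.entry i j')).unique h rfl

theorem col_injective {i i' j : Fin n} (h : L.entry i j = L.entry i' j) : i = i' :=
  (L.col_existsUnique j (L.entry i' j)).unique h rfl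

/-- Any two rows contain `n / 3` columns whose entries in these rows are pairwise disjoint. -/
theorem exists_pairwiseDisjoint_columns [DecidableEq A] (i j : Fin n) :
    ∃ K : Finset (Fin n), n ≤ 3 * K.card ∧
      (K : Set (Fin n)).PairwiseDisjoint fun k => ({L.entry i k, L.entry j k} : Finset A) := by
  classical
  set f : Fin n → Finset A := fun k => {L.entry i k, L.entry j k} with hf
  obtain ⟨K, hK, hmax⟩ := Finset.exists_max_image
    (Finset.univ.filter fun K : Finset (Fin n) => (K : Set (Fin n)).PairwiseDisjoint f)
    Finset.card ⟨∅, by simp⟩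
  simp only [Finset.mem_filter, Finset.mem_univ, true_and] at hK hmax
  refine ⟨K, ?_, hK⟩
  -- By maximality of `K`, every column meets a column of `K`.
  have hcov : (Finset.univ : Finset (Fin n)) ⊆
      K.biUnion fun k' => Finset.univ.filter fun k => ¬ Disjoint (f k) (f k') := by
    intro k _
    simp only [Finset.mem_biUnion, Finset.mem_filter, Finset.mem_univ, true_and]
    by_contra! hcon
    have hk : k ∉ K := fun hk => by
      have := hcon k hk
      simp [hf] at this
    have := hmax (insert k K) (by
      rw [Finset.coe_insert]
      exact hK.insert fun k' hk' _ => hcon k' hk')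
    rw [Finset.card_insert_of_notMem hk] at this
    omega
  have hcard := (Finset.card_le_card hcov).trans (Finset.card_biUnion_le_card_mul _ _ 3 ?_)
  · simpa [mul_comm] using hcard
  · intro k' _
    -- Only the columns `k'`, `r` and `s` can have a pair meeting that of `k'`.
    obtain ⟨r, hr, -⟩ := L.row_existsUnique i (L.entry j k')
    obtain ⟨s, hs, -⟩ := L.row_existsUnique j (L.entry i k')
    refine (Finset.card_le_card (t := {k', r, s}) ?_).trans Finset.card_le_three
    intro k hk
    simp only [hf, Finset.mem_filter, Finset.mem_univ, true_and, Finset.disjoint_left,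
      Finset.mem_insert, Finset.mem_singleton] at hk ⊢
    push Not at hk
    obtain ⟨a, rfl | rfl, h | h⟩ := hk
    · exact Or.inl (L.row_injective h)
    · exact Or.inr (Or.inl (L.row_injective (h.trans hr.symm)))
    · exact Or.inr (Or.inr (L.row_injective (h.trans hs.symm)))
    · exact Or.inl (L.row_injective h)

open ProbabilityTheory in
theorem setBernoulli_not_joined_le (p : unitInterval) {i j : Fin n} (hij : i ≠ j) :
    (setBernoulli (Set.univ : Set A) p).real
      {S | ¬ (i = j ∨ (L.graph S).Adj i j ∨ ∃ k, (L.graph S).Adj i k ∧ (L.graph S).Adj k j)} ≤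
      Real.exp (-((p : ℝ) ^ 2 * n / 3)) := by
  classical
  obtain ⟨K, hK, hdis⟩ := L.exists_pairwiseDisjoint_columns i j
  set f : Fin n → Finset A := fun k => {L.entry i k, L.entry j k} with hf
  have hinj : Set.InjOn f K := by
    intro k hk k' hk' h
    by_contra hne
    have := hdis hk hk' hne
    change Disjoint (f k) (f k') at this
    rw [h, Finset.disjoint_self_iff_empty] at this
    simp [hf] at this
  have hsub : {S | ¬ (i = j ∨ (L.graph S).Adj i j ∨
      ∃ k, (L.graph S).Adj i k ∧ (L.graph S).Adj k j)} ⊆ avoiding (K.image f) := by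
    intro S hS g hg hgS
    obtain ⟨k, -, rfl⟩ := Finset.mem_image.1 hg
    simp only [hf, Finset.coe_insert, Finset.coe_singleton, Set.insert_subset_iff,
      Set.singleton_subset_iff] at hgS
    refine hS (Or.inr ?_)
    -- The columns `i` and `j` give no intermediate vertex, but their pairs contain an entry joining
    -- `i` to `j` directly.
    by_cases hki : k = i
    · subst hki; exact Or.inl ⟨hij, Or.inr hgS.2⟩
    by_cases hkj : k = j
    · subst hkj; exact Or.inl ⟨hij, Or.inl hgS.1⟩
    · exact Or.inr ⟨k, ⟨Ne.symm hki, Or.inl hgS.1⟩, ⟨hkj, Or.inr hgS.2⟩⟩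
  have hp0 : (0 : ℝ) ≤ p := p.2.1
  have hp1 : (p : ℝ) ^ 2 ≤ 1 := pow_le_one₀ hp0 p.2.2
  have h1 := setBernoulli_avoiding_le p 0 (K.image f) (by
      intro g hg
      obtain ⟨k, -, rfl⟩ := Finset.mem_image.1 hg
      exact Finset.card_pair fun h => hij (L.col_injective h)) (by
      intro e he
      obtain ⟨k, hk, rfl⟩ := Finset.mem_image.1 he
      rw [Nat.le_zero, Finset.card_eq_zero, Finset.sdiff_eq_empty_iff_subset,
        Finset.biUnion_subset]
      intro g hg
      rw [Finset.mem_filter] at hg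
      obtain ⟨hg, hd⟩ := hg
      obtain ⟨k', hk', rfl⟩ := Finset.mem_image.1 hg
      by_cases h : k' = k
      · subst h; exact le_rfl
      · exact absurd (hdis hk' hk h) hd)
  rw [Finset.card_image_of_injOn hinj, pow_zero, mul_one] at h1
  refine (measureReal_mono hsub).trans (h1.trans ?_)
  have h2 : (1 - (p : ℝ) ^ 2) ≤ Real.exp (-(p : ℝ) ^ 2) := by
    have := Real.add_one_le_exp (-(p : ℝ) ^ 2); linarith
  refine (pow_le_pow_left₀ (sub_nonneg.2 hp1) h2 _).trans ?_
  rw [← Real.exp_nat_mul, Real.exp_le_exp]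
  have : (n : ℝ) ≤ 3 * K.card := by exact_mod_cast hK
  nlinarith [sq_nonneg (p : ℝ)]

theorem randomGraph_real_apply (p : unitInterval) (E : Set (SimpleGraph (Fin n))) :
    (L.randomGraph p).real E =
      (ProbabilityTheory.setBernoulli (Set.univ : Set A) p).real {S | L.graph S ∈ E} := by
  rw [Measure.real, L.randomGraph_apply]; rfl

open ProbabilityTheory in
theorem one_sub_le_randomGraph_ediam_le_two (p : unitInterval) :
    1 - (n : ℝ) ^ 2 * Real.exp (-((p : ℝ) ^ 2 * n / 3)) ≤
      (L.randomGraph p).real {Γ | Γ.ediam ≤ 2} := by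
  classical
  have hc : (L.randomGraph p).real {Γ | Γ.ediam ≤ 2}ᶜ ≤
      (n : ℝ) ^ 2 * Real.exp (-((p : ℝ) ^ 2 * n / 3)) := by
    rw [randomGraph_real_apply]
    have hsub : {S | L.graph S ∈ ({Γ | Γ.ediam ≤ 2} : Set (SimpleGraph (Fin n)))ᶜ} ⊆
        ⋃ x ∈ (Finset.univ : Finset (Fin n × Fin n)),
          {S | ¬ (x.1 = x.2 ∨ (L.graph S).Adj x.1 x.2 ∨
            ∃ k, (L.graph S).Adj x.1 k ∧ (L.graph S).Adj k x.2)} := by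
      intro S hS
      simp only [Set.mem_ofPred_eq, Set.mem_compl_iff, ediam_le_two_iff] at hS
      push Not at hS
      obtain ⟨u, v, h⟩ := hS
      simp only [Set.mem_iUnion]
      refine ⟨(u, v), Finset.mem_univ _, ?_⟩
      simp only [Set.mem_ofPred_eq]
      push Not
      exact h
    refine (measureReal_mono hsub (measure_ne_top _ _)).trans
      ((measureReal_biUnion_finset_le _ _).trans ?_)
    refine (Finset.sum_le_card_nsmul _ _ (Real.exp (-((p : ℝ) ^ 2 * n / 3))) ?_).trans ?_
    · rintro ⟨i, j⟩ -
      by_cases hij : i = j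
      · simp [hij, Real.exp_nonneg]
      · exact L.setBernoulli_not_joined_le p hij
    · simp [sq]
  rw [probReal_compl_eq_one_sub (measurableSet_simpleGraph _)] at hc
  linarith

end Joined

theorem tendsto_measure_one_of_real {ι : Type*} {l : Filter ι} {Ω : ι → Type*}
    [∀ k, MeasurableSpace (Ω k)] (μ : ∀ k, Measure (Ω k)) [∀ k, IsProbabilityMeasure (μ k)]
    (E : ∀ k, Set (Ω k)) {g : ι → ℝ} (hg : Filter.Tendsto g l (nhds 1))
    (h : ∀ᶠ k in l, g k ≤ (μ k).real (E k)) :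
    Filter.Tendsto (fun k => μ k (E k)) l (nhds 1) := by
  have h1 : Filter.Tendsto (fun k => (μ k).real (E k)) l (nhds 1) :=
    tendsto_of_tendsto_of_tendsto_of_le_of_le' hg tendsto_const_nhds h
      (Filter.Eventually.of_forall fun k => measureReal_le_one)
  have h2 := ENNReal.tendsto_ofReal h1
  simpa [Measure.real] using h2

theorem tendsto_ediam_le_two {ε : ℝ} (hε : 0 < ε)
    {n : ℕ → ℕ} (hn : Filter.Tendsto n Filter.atTop Filter.atTop)
    {A : ℕ → Type*} [∀ k, Fintype (A k)] (L : ∀ k, LatinSquare (n k) (A k))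
    (p : ℕ → unitInterval)
    (hp : ∀ᶠ k in Filter.atTop, √((26 + ε) * (Real.log (n k) / (n k))) ≤ (p k : ℝ)) :
    Filter.Tendsto (fun k => (L k).randomGraph (p k) {Γ | Γ.ediam ≤ 2})
      Filter.atTop (nhds 1) := by
  refine tendsto_measure_one_of_real (g := fun k => 1 - ((n k : ℕ) : ℝ)⁻¹) _ _ ?_ ?_
  · simpa using tendsto_const_nhds.sub
      (tendsto_inv_atTop_zero.comp (tendsto_natCast_atTop_atTop (R := ℝ) |>.comp hn))
  · filter_upwards [hp, hn.eventually_ge_atTop 1] with k hk hnk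
    refine le_trans ?_ ((L k).one_sub_le_randomGraph_ediam_le_two (p k))
    have hN : (1 : ℝ) ≤ n k := by exact_mod_cast hnk
    have hlog : 0 ≤ Real.log (n k) := Real.log_nonneg hN
    have h1 : (26 + ε) * (Real.log (n k) / (n k)) ≤ (p k : ℝ) ^ 2 :=
      (Real.sqrt_le_left (p k).2.1).1 hk
    have h2 : 26 * Real.log (n k) ≤ (p k : ℝ) ^ 2 * n k := by
      have := mul_le_mul_of_nonneg_right h1 (by linarith : (0 : ℝ) ≤ n k)
      have h3 : (26 + ε) * (Real.log (n k) / (n k)) * n k = (26 + ε) * Real.log (n k) := by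
        field_simp
      nlinarith
    -- Since `26 / 3 ≥ 3`, the failure probability is at most `n⁻³`, which beats the `n²` pairs.
    have h4 : Real.exp (-((p k : ℝ) ^ 2 * n k / 3)) ≤ Real.exp (-(3 * Real.log (n k))) := by
      rw [Real.exp_le_exp]; linarith
    have h5 : Real.exp (-(3 * Real.log (n k))) = ((n k : ℝ) ^ 3)⁻¹ := by
      rw [Real.exp_neg, mul_comm, Real.exp_mul, Real.exp_log (by linarith)]; norm_cast
    have h6 : (n k : ℝ) ^ 2 * ((n k : ℝ) ^ 3)⁻¹ = (n k : ℝ)⁻¹ := by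
      field_simp
    have := mul_le_mul_of_nonneg_left (h5 ▸ h4) (sq_nonneg (n k : ℝ))
    linarith

/-! ### Counting the paths of length two from a fixed vertex. -/

section Links

variable {n : ℕ} {A : Type*} [Fintype A] (L : LatinSquare n A)

/-- The `k`-th entry of the `i`-th row (for `s = true`) or of the `i`-th column. -/
def line (s : Bool) (i k : Fin n) : A :=
  if s then L.entry i k else L.entry k i

theorem line_injective (s : Bool) (i : Fin n) : Function.Injective (L.line s i) := by
  intro k k' h
  cases s
  · exact L.col_injective (by simpa [line] using h)
  · exact L.row_injective (by simpa [line] using h)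

theorem line_injective_left {s : Bool} {i i' k : Fin n} (h : L.line s i k = L.line s i' k) :
    i = i' := by
  cases s
  · exact L.row_injective (by simpa [line] using h)
  · exact L.col_injective (by simpa [line] using h)

theorem exists_line_mem_of_adj {S : Set A} {i k : Fin n} (h : (L.graph S).Adj i k) :
    ∃ s, L.line s i k ∈ S := by
  rcases h.2 with h | h
  · exact ⟨true, by simpa [line] using h⟩
  · exact ⟨false, by simpa [line] using h⟩

variable [DecidableEq A]

/-- For `t = (k, s, s')`: the two entries whose presence in `S` makes `k` a common neighbour of
`o` and `j`, each read from the row or from the column as `s` and `s'` prescribe. -/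
def linkPair (o j : Fin n) (t : Fin n × Bool × Bool) : Finset A :=
  {L.line t.2.1 o t.1, L.line t.2.2 j t.1}

/-- The two-element sets of entries that join `o` to `j` by a path of length two. -/
def links (o j : Fin n) : Finset (Finset A) :=
  (Finset.univ.image (L.linkPair o j)).filter fun f => f.card = 2

/-- The indices for which a single entry joins `o` to `j` by a path of length two. -/
def coincidences (o j : Fin n) : Finset (Fin n × Bool × Bool) :=
  Finset.univ.filter fun t => L.line t.2.1 o t.1 = L.line t.2.2 j t.1

/-- The one-element sets of entries that join `o` to `j` by a path of length at most two. -/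
def singles (o j : Fin n) : Finset (Finset A) :=
  (L.coincidences o j).image (L.linkPair o j) ∪ {{L.entry o j}, {L.entry j o}}

theorem card_of_mem_links {o j : Fin n} {f : Finset A} (hf : f ∈ L.links o j) : f.card = 2 :=
  (Finset.mem_filter.1 hf).2

theorem card_of_mem_singles {o j : Fin n} {f : Finset A} (hf : f ∈ L.singles o j) :
    f.card = 1 := by
  simp only [singles, Finset.mem_union, Finset.mem_image, coincidences, Finset.mem_filter,
    Finset.mem_univ, true_and, Finset.mem_insert, Finset.mem_singleton] at hf
  rcases hf with ⟨t, ht, rfl⟩ | rfl | rfl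
  · simp [linkPair, ht]
  · simp
  · simp

theorem card_links_le (o j : Fin n) : (L.links o j).card ≤ 4 * n := by
  refine (Finset.card_filter_le _ _).trans (Finset.card_image_le.trans ?_)
  simp; omega

theorem card_singles_le (o j : Fin n) :
    (L.singles o j).card ≤ (L.coincidences o j).card + 2 :=
  (Finset.card_union_le _ _).trans (add_le_add Finset.card_image_le Finset.card_le_two)

theorem two_lt_ediam_of_avoiding {S : Set A} {o j : Fin n} (hoj : o ≠ j)
    (hS : S ∈ avoiding (L.links o j ∪ L.singles o j)) : 2 < (L.graph S).ediam := by
  rw [← not_le, ediam_le_two_iff]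
  intro h
  rcases h o j with h | h | ⟨k, h1, h2⟩
  · exact hoj h
  · rcases h.2 with h | h
    · exact hS {L.entry o j} (by simp [singles]) (by simpa using h)
    · exact hS {L.entry j o} (by simp [singles]) (by simpa using h)
  · obtain ⟨s, hs⟩ := L.exists_line_mem_of_adj h1
    obtain ⟨s', hs'⟩ := L.exists_line_mem_of_adj h2.symm
    refine hS (L.linkPair o j (k, s, s')) ?_ ?_
    · rw [Finset.mem_union]
      by_cases heq : L.line s o k = L.line s' j k
      · refine Or.inr (Finset.mem_union_left _ (Finset.mem_image_of_mem _ ?_))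
        simpa [coincidences] using heq
      · refine Or.inl (Finset.mem_filter.2 ⟨Finset.mem_image_of_mem _ (Finset.mem_univ _), ?_⟩)
        exact Finset.card_pair heq
    · simp only [linkPair, Finset.coe_insert, Finset.coe_singleton, Set.insert_subset_iff,
        Set.singleton_subset_iff]
      exact ⟨hs, hs'⟩

/-- For each of the four readings `(s, s')`, the element `a` occurs once in the line of `o` and once
in that of `j`. -/
theorem card_filter_mem_links_le (o j : Fin n) (a : A) :
    ((L.links o j).filter fun f => a ∈ f).card ≤ 8 := by
  have h1 : ((L.links o j).filter fun f => a ∈ f) ⊆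
      ((Finset.univ.filter fun t : Fin n × Bool × Bool => L.line t.2.1 o t.1 = a) ∪
        (Finset.univ.filter fun t : Fin n × Bool × Bool => L.line t.2.2 j t.1 = a)).image
        (L.linkPair o j) := by
    intro f hf
    simp only [links, Finset.mem_filter, Finset.mem_image, Finset.mem_univ, true_and] at hf
    obtain ⟨⟨⟨t, rfl⟩, -⟩, ha⟩ := hf
    refine Finset.mem_image_of_mem _ ?_
    simp only [linkPair, Finset.mem_insert, Finset.mem_singleton] at ha
    simpa [eq_comm] using ha
  refine (Finset.card_le_card h1).trans (Finset.card_image_le.trans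
    ((Finset.card_union_le _ _).trans ?_))
  have hb : (Finset.univ : Finset (Bool × Bool)).card = 4 := by decide
  have h2 : (Finset.univ.filter fun t : Fin n × Bool × Bool => L.line t.2.1 o t.1 = a).card ≤ 4 := by
    rw [← hb]
    refine Finset.card_le_card_of_injOn (fun t => t.2) (fun _ _ => Finset.mem_univ _) ?_
    rintro ⟨k, s⟩ hk ⟨k', s'⟩ hk' h
    simp only [Finset.coe_filter, Finset.mem_univ, true_and, Set.mem_ofPred_eq] at hk hk' h
    subst h
    rw [L.line_injective _ _ (hk.trans hk'.symm)]
  have h3 : (Finset.univ.filter fun t : Fin n × Bool × Bool => L.line t.2.2 j t.1 = a).card ≤ 4 := by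
    rw [← hb]
    refine Finset.card_le_card_of_injOn (fun t => t.2) (fun _ _ => Finset.mem_univ _) ?_
    rintro ⟨k, s⟩ hk ⟨k', s'⟩ hk' h
    simp only [Finset.coe_filter, Finset.mem_univ, true_and, Set.mem_ofPred_eq] at hk hk' h
    subst h
    rw [L.line_injective _ _ (hk.trans hk'.symm)]
  omega

/-- Choose a reading (4 ways) and which elements of `e` belong to `o` and to `j` (at most 4 ways).
The first element then determines `k`, and `k` with the second determines `j`. -/
theorem card_filter_links_mem_le (o : Fin n) {e : Finset A} (he : e.card = 2) :
    (Finset.univ.filter fun j => e ∈ L.links o j).card ≤ 16 := by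
  have hb : ((Finset.univ : Finset (Bool × Bool)) ×ˢ (e ×ˢ e)).card = 16 := by
    simp [Finset.card_product, he]
  rw [← hb]
  refine Finset.card_le_card_of_forall_subsingleton
    (fun j x => ∃ k, L.line x.1.1 o k = x.2.1 ∧ L.line x.1.2 j k = x.2.2) ?_ ?_
  · intro j hj
    simp only [links, Finset.mem_filter, Finset.mem_univ, true_and, Finset.mem_image] at hj
    obtain ⟨⟨t, rfl⟩, -⟩ := hj
    exact ⟨(t.2, (L.line t.2.1 o t.1, L.line t.2.2 j t.1)), by simp [linkPair], t.1, rfl, rfl⟩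
  · rintro x - j ⟨-, k, h1, h2⟩ j' ⟨-, k', h1', h2'⟩
    have := L.line_injective _ _ (h1.trans h1'.symm)
    subst this
    exact L.line_injective_left (h2.trans h2'.symm)

theorem sum_card_inter_links_le (o j : Fin n) :
    ∑ j', (L.links o j ∩ L.links o j').card ≤ 64 * n := by
  have h : ∀ j', (L.links o j ∩ L.links o j').card =
      ∑ e ∈ L.links o j, if e ∈ L.links o j' then 1 else 0 := fun j' => by
    rw [← Finset.card_filter, Finset.filter_mem_eq_inter]
  simp_rw [h]
  rw [Finset.sum_comm]
  refine (Finset.sum_le_card_nsmul _ _ 16 fun e he => ?_).trans ?_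
  · rw [← Finset.card_filter]
    exact L.card_filter_links_mem_le o (L.card_of_mem_links he)
  · have := L.card_links_le o j
    rw [smul_eq_mul]; omega

/-- The vertices other than `o` for which few single entries make a path of length two to `o`. -/
def targets (o : Fin n) : Finset (Fin n) :=
  Finset.univ.filter fun j => o ≠ j ∧ (L.coincidences o j).card ≤ 8

theorem sum_card_coincidences_le (o : Fin n) : ∑ j, (L.coincidences o j).card ≤ 4 * n := by
  simp only [coincidences, Finset.card_filter]
  rw [Finset.sum_comm]
  refine (Finset.sum_le_card_nsmul _ _ 1 fun t _ => ?_).trans ?_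
  · rw [← Finset.card_filter, Finset.card_le_one]
    intro j hj j' hj'
    rw [Finset.mem_filter] at hj hj'
    exact L.line_injective_left (hj.2.symm.trans hj'.2)
  · simp; omega

theorem card_targets_ge (o : Fin n) (hn : 4 ≤ n) : n ≤ 4 * (L.targets o).card := by
  set B := Finset.univ.filter fun j => ¬ (L.coincidences o j).card ≤ 8 with hB
  -- Markov's inequality: at most `4 n / 9` vertices are excluded besides `o`, which leaves at least
  -- `n / 4` once `n ≥ 4`.
  have h1 : B.card * 9 ≤ 4 * n :=
    calc B.card * 9 = ∑ j ∈ B, 9 := by simp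
      _ ≤ ∑ j ∈ B, (L.coincidences o j).card :=
        Finset.sum_le_sum fun j hj => by
          have := (Finset.mem_filter.1 hj).2
          omega
      _ ≤ ∑ j, (L.coincidences o j).card :=
        Finset.sum_le_sum_of_subset (Finset.subset_univ _)
      _ ≤ 4 * n := L.sum_card_coincidences_le o
  have h2 : (Finset.univ : Finset (Fin n)) ⊆ insert o (L.targets o ∪ B) := by
    intro j _
    simp only [targets, hB, Finset.mem_insert, Finset.mem_union, Finset.mem_filter,
      Finset.mem_univ, true_and]
    by_cases h : o = j
    · exact Or.inl h.symm
    · tauto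
  have h3 := Finset.card_le_card h2
  have h4 := Finset.card_insert_le o (L.targets o ∪ B)
  have h5 := Finset.card_union_le (L.targets o) B
  simp only [Finset.card_univ, Fintype.card_fin] at h3
  omega

open ProbabilityTheory

theorem le_setBernoulli_avoiding (p : unitInterval) {o j : Fin n} (hj : j ∈ L.targets o) :
    (1 - (p : ℝ) ^ 2) ^ (L.links o j).card * (1 - p : ℝ) ^ 10 ≤
      (setBernoulli (Set.univ : Set A) p).real (avoiding (L.links o j ∪ L.singles o j)) := by
  refine le_trans ?_ (prod_le_setBernoulli_avoiding p _)
  have hdis : Disjoint (L.links o j) (L.singles o j) := by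
    rw [Finset.disjoint_left]
    intro f h1 h2
    have h1 := L.card_of_mem_links h1
    have h2 := L.card_of_mem_singles h2
    omega
  have hp0 : (0 : ℝ) ≤ p := p.2.1
  have hp1 : (0 : ℝ) ≤ 1 - p := sub_nonneg.2 p.2.2
  rw [Finset.prod_union hdis,
    Finset.prod_congr (g := fun _ => 1 - (p : ℝ) ^ 2) rfl fun f hf => by
      rw [L.card_of_mem_links hf],
    Finset.prod_congr (s₁ := L.singles o j) (g := fun _ => 1 - (p : ℝ)) rfl fun f hf => by
      rw [L.card_of_mem_singles hf, pow_one],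
    Finset.prod_const, Finset.prod_const]
  -- At most eight coincidences, plus the two entries joining `o` and `j` directly.
  have hcard : (L.singles o j).card ≤ 10 :=
    (L.card_singles_le o j).trans (by
      have := (Finset.mem_filter.1 hj).2.2
      omega)
  exact mul_le_mul_of_nonneg_left (pow_le_pow_of_le_one hp1 (by linarith) hcard)
    (pow_nonneg (sub_nonneg.2 (pow_le_one₀ hp0 p.2.2)) _)

theorem setBernoulli_avoiding_inter_le (p : unitInterval) (o j j' : Fin n) :
    (setBernoulli (Set.univ : Set A) p).real
      (avoiding (L.links o j ∪ L.singles o j) ∩ avoiding (L.links o j' ∪ L.singles o j')) ≤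
      (1 - (p : ℝ) ^ 2 * (1 - p : ℝ) ^ 64) ^ (L.links o j ∪ L.links o j').card := by
  rw [← avoiding_union]
  refine (measureReal_mono (avoiding_anti (F := L.links o j ∪ L.links o j') ?_)).trans
    (setBernoulli_avoiding_le p 64 _ ?_ ?_)
  · exact Finset.union_subset_union Finset.subset_union_left Finset.subset_union_left
  · intro f hf
    rcases Finset.mem_union.1 hf with h | h <;> exact L.card_of_mem_links h
  · intro e he
    have hcard : ∀ f ∈ L.links o j ∪ L.links o j', f.card = 2 := fun f hf => by
      rcases Finset.mem_union.1 hf with h | h <;> exact L.card_of_mem_links h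
    have h1 : ((L.links o j ∪ L.links o j').filter fun f => ¬ Disjoint f e) ⊆
        e.biUnion fun a => ((L.links o j).filter fun f => a ∈ f) ∪
          ((L.links o j').filter fun f => a ∈ f) := by
      intro f hf
      simp only [Finset.mem_filter, Finset.not_disjoint_iff, Finset.mem_union] at hf
      obtain ⟨hf, a, haf, hae⟩ := hf
      simp only [Finset.mem_biUnion, Finset.mem_union, Finset.mem_filter]
      exact ⟨a, hae, hf.imp (fun h => ⟨h, haf⟩) fun h => ⟨h, haf⟩⟩
    -- Each of the two elements of `e` lies in at most eight pairs of either family; 32 pairs have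
    -- at most 64 elements, whence the exponent.
    have h2 : ((L.links o j ∪ L.links o j').filter fun f => ¬ Disjoint f e).card ≤ 32 := by
      refine (Finset.card_le_card h1).trans ((Finset.card_biUnion_le_card_mul _ _ 16 ?_).trans ?_)
      · intro a _
        have h3 := L.card_filter_mem_links_le o j a
        have h4 := L.card_filter_mem_links_le o j' a
        exact (Finset.card_union_le _ _).trans (by omega)
      · rw [hcard e he]
    refine (Finset.card_le_card Finset.sdiff_subset).trans
      ((Finset.card_biUnion_le_card_mul _ _ 2 fun f hf => ?_).trans ?_)
    · exact (hcard f (Finset.mem_filter.1 hf).1).le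
    · omega

end Links

/-! ### The second moment argument. -/

/-- The second moment method for a finite family of events in a finite probability space. -/
theorem sq_sum_measureReal_le {Ω ι : Type*} [Fintype Ω] [MeasurableSpace Ω]
    [MeasurableSingletonClass Ω] (μ : Measure Ω) [IsFiniteMeasure μ] (J : Finset ι)
    (E : ι → Set Ω) :
    (∑ j ∈ J, μ.real (E j)) ^ 2 ≤
      μ.real (⋃ j ∈ J, E j) * ∑ i ∈ J, ∑ j ∈ J, μ.real (E i ∩ E j) := by
  classical
  have hμ : ∀ S : Set Ω, μ.real S = ∑ ω, μ.real {ω} * (if ω ∈ S then 1 else 0) := fun S => by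
    simp only [mul_ite, mul_one, mul_zero, ← Finset.sum_filter]
    rw [sum_measureReal_singleton]
    congr 1; ext; simp
  set X : Ω → ℝ := fun ω => ∑ j ∈ J, if ω ∈ E j then 1 else 0 with hX
  set U : Ω → ℝ := fun ω => if ω ∈ ⋃ j ∈ J, E j then 1 else 0 with hU
  have h1 : ∑ j ∈ J, μ.real (E j) = ∑ ω, μ.real {ω} * X ω := by
    simp only [hX, Finset.mul_sum]
    rw [Finset.sum_comm]
    exact Finset.sum_congr rfl fun j _ => hμ _
  have h2 : ∑ i ∈ J, ∑ j ∈ J, μ.real (E i ∩ E j) = ∑ ω, μ.real {ω} * X ω ^ 2 := by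
    have hsq : ∀ ω, μ.real {ω} * X ω ^ 2 = ∑ i ∈ J, ∑ j ∈ J,
        μ.real {ω} * ((if ω ∈ E i then 1 else 0) * if ω ∈ E j then 1 else 0) := fun ω => by
      rw [sq, hX, Finset.sum_mul_sum]
      simp only [Finset.mul_sum]
    simp only [hsq]
    symm
    rw [Finset.sum_comm]
    refine Finset.sum_congr rfl fun i _ => ?_
    rw [Finset.sum_comm]
    refine Finset.sum_congr rfl fun j _ => ?_
    rw [hμ]
    refine Finset.sum_congr rfl fun ω _ => ?_
    by_cases h1 : ω ∈ E i <;> by_cases h2 : ω ∈ E j <;> simp [h1, h2]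
  have hXU : ∀ ω, U ω * X ω ^ 2 = X ω ^ 2 := fun ω => by
    by_cases h : ω ∈ ⋃ j ∈ J, E j
    · simp only [hU, if_pos h, one_mul]
    · have : X ω = 0 := Finset.sum_eq_zero fun j hj => if_neg fun hω =>
        h (Set.mem_biUnion hj hω)
      simp [this]
  rw [h1, h2, hμ]
  -- Cauchy–Schwarz for `X = U * X`, where `U` is the indicator of the union.
  refine Finset.sum_sq_le_sum_mul_sum_of_sq_le_mul _ (fun ω _ => ?_) (fun ω _ => ?_) fun ω _ => ?_
  · exact mul_nonneg measureReal_nonneg (by split_ifs <;> norm_num)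
  · exact mul_nonneg measureReal_nonneg (sq_nonneg _)
  · refine le_of_eq ?_
    change (μ.real {ω} * X ω) ^ 2 = μ.real {ω} * U ω * (μ.real {ω} * X ω ^ 2)
    linear_combination (-μ.real {ω} ^ 2) * hXU ω

-- The reciprocal of a bound on `E X² / (E X)²`, with `X` counting the targets `j` not joined to
-- `o`. In the first summand, `(y / a) ^ (8 n)` compares the upper and lower avoidance rates, `y ^
-- M` pays for the overlap and `(1 - p) ^ 20` for the single entries. The second summand comes from
-- the pairs with large overlap; `256 = 64 * 4`, from `64 n / M` bad partners and at least `n / 4`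
-- targets.
open ProbabilityTheory in
theorem inv_le_randomGraph_two_lt_ediam {n : ℕ} {A : Type*} [Fintype A] (L : LatinSquare n A)
    (hn : 4 ≤ n) (p : unitInterval) (hp : (p : ℝ) < 1) (M : ℕ) (hM : 1 ≤ M) :
    (((1 - (p : ℝ) ^ 2 * (1 - p : ℝ) ^ 64) / (1 - (p : ℝ) ^ 2)) ^ (8 * n) *
        ((1 - (p : ℝ) ^ 2 * (1 - p : ℝ) ^ 64) ^ M)⁻¹ * ((1 - p : ℝ) ^ 20)⁻¹ +
      256 / (M * ((1 - (p : ℝ) ^ 2) ^ (4 * n) * (1 - p : ℝ) ^ 10)))⁻¹ ≤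
      (L.randomGraph p).real {Γ | 2 < Γ.ediam} := by
  classical
  have hp0 : (0 : ℝ) ≤ p := p.2.1
  set r : ℝ := (1 - p : ℝ) ^ 10 with hr
  set a : ℝ := 1 - (p : ℝ) ^ 2 with ha
  set y : ℝ := 1 - (p : ℝ) ^ 2 * (1 - p : ℝ) ^ 64 with hy
  have hr0 : 0 < r := pow_pos (sub_pos.2 hp) _
  have ha0 : 0 < a := sub_pos.2 (pow_lt_one₀ hp0 hp (by norm_num))
  have ha1 : a ≤ 1 := sub_le_self _ (sq_nonneg _)
  have hay : a ≤ y := by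
    have : (1 - p : ℝ) ^ 64 ≤ 1 := pow_le_one₀ (sub_nonneg.2 hp.le) (by linarith)
    have := mul_le_mul_of_nonneg_left this (sq_nonneg (p : ℝ))
    rw [ha, hy]; linarith
  have hy0 : 0 < y := ha0.trans_le hay
  have hy1 : y ≤ 1 := sub_le_self _ (mul_nonneg (sq_nonneg _) (pow_nonneg (by linarith) _))
  have hr2 : (1 - p : ℝ) ^ 20 = r ^ 2 := by rw [hr]; ring
  rw [hr2]
  set θ : ℝ := (y / a) ^ (8 * n) * (y ^ M)⁻¹ * (r ^ 2)⁻¹ with hθ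
  have hθ0 : 0 < θ := by positivity
  have hn0 : (0 : ℝ) < n := by exact_mod_cast (by omega : 0 < n)
  have hM0 : (0 : ℝ) < M := by exact_mod_cast hM
  let o : Fin n := ⟨0, by omega⟩
  set μ := setBernoulli (Set.univ : Set A) p with hμ
  set J := L.targets o with hJ
  set E : Fin n → Set (Set A) := fun j => avoiding (L.links o j ∪ L.singles o j) with hE
  set m : ℝ := ∑ j ∈ J, μ.real (E j) with hm
  have hq : ∀ j ∈ J, a ^ (L.links o j).card * r ≤ μ.real (E j) :=
    fun j hj => L.le_setBernoulli_avoiding p hj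
  have hq' : ∀ j ∈ J, a ^ (4 * n) * r ≤ μ.real (E j) := fun j hj =>
    (mul_le_mul_of_nonneg_right (pow_le_pow_of_le_one ha0.le ha1 (L.card_links_le o j))
      hr0.le).trans (hq j hj)
  have hmlow : n / 4 * (a ^ (4 * n) * r) ≤ m := by
    have h1 := Finset.card_nsmul_le_sum J _ _ hq'
    have h2 : (n : ℝ) ≤ 4 * J.card := by exact_mod_cast L.card_targets_ge o hn
    rw [nsmul_eq_mul] at h1
    refine le_trans (mul_le_mul_of_nonneg_right ?_ (by positivity)) h1
    linarith
  have hm0 : 0 < m := lt_of_lt_of_le (by positivity) hmlow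
  have hgood : ∀ i ∈ J, ∀ j ∈ J, (L.links o i ∩ L.links o j).card ≤ M →
      μ.real (E i ∩ E j) ≤ θ * (μ.real (E i) * μ.real (E j)) := by
    intro i hi j hj hij
    refine (L.setBernoulli_avoiding_inter_le p o i j).trans ?_
    have hcard := Finset.card_union_add_card_inter (L.links o i) (L.links o j)
    set u := (L.links o i ∪ L.links o j).card
    set v := (L.links o i ∩ L.links o j).card
    set l := (L.links o i).card with hl
    set l' := (L.links o j).card with hl'
    have hll : l + l' ≤ 8 * n := by
      have := L.card_links_le o i
      have := L.card_links_le o j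
      omega
    change y ^ u ≤ _
    -- Here `l + l' = u + v` and `v ≤ M`.
    have h1 : y ^ u * y ^ M ≤ y ^ (l + l') := by
      rw [← pow_add]
      exact pow_le_pow_of_le_one hy0.le hy1 (by omega)
    have h2 : y ^ (l + l') = (y / a) ^ (l + l') * a ^ (l + l') := by
      rw [← mul_pow, div_mul_cancel₀ _ ha0.ne']
    have h3 : (y / a) ^ (l + l') ≤ (y / a) ^ (8 * n) :=
      pow_le_pow_right₀ ((one_le_div ha0).2 hay) hll
    have h4 : (a ^ l * r) * (a ^ l' * r) ≤ μ.real (E i) * μ.real (E j) :=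
      mul_le_mul (hq i hi) (hq j hj) (by positivity) measureReal_nonneg
    calc y ^ u ≤ y ^ (l + l') * (y ^ M)⁻¹ := by
          rw [← div_eq_mul_inv, le_div_iff₀ (by positivity)]; exact h1
      _ ≤ (y / a) ^ (8 * n) * a ^ (l + l') * (y ^ M)⁻¹ := by
          rw [h2]; gcongr
      _ = θ * ((a ^ l * r) * (a ^ l' * r)) := by
          rw [hθ]; field_simp; ring
      _ ≤ _ := mul_le_mul_of_nonneg_left h4 hθ0.le
  -- Markov's inequality for the total overlap `64 n`.
  have hbad : ∀ i, ((J.filter fun j => ¬ (L.links o i ∩ L.links o j).card ≤ M).card : ℝ) ≤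
      64 * n / M := by
    intro i
    rw [le_div_iff₀ hM0]
    have : (J.filter fun j => ¬ (L.links o i ∩ L.links o j).card ≤ M).card * M ≤ 64 * n := by
      refine le_trans ?_ (L.sum_card_inter_links_le o i)
      rw [← smul_eq_mul]
      refine (Finset.card_nsmul_le_sum _ (fun j => (L.links o i ∩ L.links o j).card) M ?_).trans
        (Finset.sum_le_sum_of_subset (Finset.subset_univ _))
      intro j hj
      have := (Finset.mem_filter.1 hj).2
      omega
    exact_mod_cast this
  have hQ : ∑ i ∈ J, ∑ j ∈ J, μ.real (E i ∩ E j) ≤ θ * m ^ 2 + 64 * n / M * m := by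
    calc _ ≤ ∑ i ∈ J, (θ * μ.real (E i) * m + 64 * n / M * μ.real (E i)) := by
          refine Finset.sum_le_sum fun i hi => ?_
          rw [← Finset.sum_filter_add_sum_filter_not J
            fun j => (L.links o i ∩ L.links o j).card ≤ M]
          refine add_le_add ?_ ?_
          · rw [hm, Finset.mul_sum]
            refine (Finset.sum_le_sum fun j hj => ?_).trans
              (Finset.sum_le_sum_of_subset_of_nonneg (Finset.filter_subset _ _)
                fun j _ _ => mul_nonneg (mul_nonneg hθ0.le measureReal_nonneg) measureReal_nonneg)
            rw [Finset.mem_filter] at hj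
            rw [mul_assoc]
            exact hgood i hi j hj.1 hj.2
          · refine (Finset.sum_le_card_nsmul _ _ (μ.real (E i)) fun j _ =>
              measureReal_mono Set.inter_subset_left).trans ?_
            rw [nsmul_eq_mul]
            exact mul_le_mul_of_nonneg_right (hbad i) measureReal_nonneg
      _ = _ := by
          rw [Finset.sum_add_distrib, ← Finset.mul_sum, ← Finset.sum_mul, ← Finset.mul_sum]
          ring
  have hP : μ.real (⋃ j ∈ J, E j) ≤ (L.randomGraph p).real {Γ | 2 < Γ.ediam} := by
    rw [randomGraph_real_apply]
    refine measureReal_mono fun S hS => ?_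
    simp only [Set.mem_iUnion] at hS
    obtain ⟨j, hj, hS⟩ := hS
    exact L.two_lt_ediam_of_avoiding (Finset.mem_filter.1 hj).2.1 hS
  refine le_trans ?_ hP
  have hsm := sq_sum_measureReal_le μ J E
  have hsm' : m ^ 2 ≤ μ.real (⋃ j ∈ J, E j) * (θ * m ^ 2 + 64 * n / M * m) :=
    hsm.trans (mul_le_mul_of_nonneg_left hQ measureReal_nonneg)
  have hB : 64 * n / M * m ≤ 256 / (M * (a ^ (4 * n) * r)) * m ^ 2 := by
    have h1 : 64 * n / M = 256 / (M * (a ^ (4 * n) * r)) * (n / 4 * (a ^ (4 * n) * r)) := by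
      field_simp; norm_num
    have h2 : (64 * n / M : ℝ) ≤ 256 / (M * (a ^ (4 * n) * r)) * m := by
      rw [h1]; exact mul_le_mul_of_nonneg_left hmlow (by positivity)
    rw [sq, ← mul_assoc]
    exact mul_le_mul_of_nonneg_right h2 hm0.le
  rw [inv_eq_one_div, div_le_iff₀ (by positivity)]
  have h5 : m ^ 2 ≤ μ.real (⋃ j ∈ J, E j) *
      (θ + 256 / (M * (a ^ (4 * n) * r))) * m ^ 2 := by
    refine hsm'.trans ?_
    rw [mul_assoc (μ.real _)]
    refine mul_le_mul_of_nonneg_left ?_ measureReal_nonneg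
    rw [add_mul]
    linarith
  exact le_of_mul_le_mul_right (by simpa using h5) (by positivity : 0 < m ^ 2)

/-! ### Asymptotics at the lower threshold. -/

theorem one_sub_pow_ge_exp {x : ℝ} (hx : x ≤ 1 / 2) (k : ℕ) :
    Real.exp (-(k * x + 2 * k * x ^ 2)) ≤ (1 - x) ^ k := by
  have h1 : Real.exp (-(x + 2 * x ^ 2)) ≤ 1 - x := by
    rw [Real.exp_neg]
    refine inv_le_of_inv_le₀ (by linarith) ?_
    have h2 := Real.add_one_le_exp (x + 2 * x ^ 2)
    refine le_trans ?_ h2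
    rw [inv_eq_one_div, div_le_iff₀ (by linarith)]
    -- `(1 - x) (1 + x + 2 x²) = 1 + x² (1 - 2 x)`.
    nlinarith [mul_nonneg (sq_nonneg x) (sub_nonneg.2 hx)]
  have h3 := pow_le_pow_left₀ (Real.exp_nonneg _) h1 k
  rw [← Real.exp_nat_mul] at h3
  refine le_trans (le_of_eq ?_) h3
  congr 1; ring

/-- An exponential form of the lower bound for the probability that the diameter exceeds two. -/
theorem exp_inv_le_randomGraph_two_lt_ediam {n : ℕ} {A : Type*} [Fintype A]
    (L : LatinSquare n A) (hn : 4 ≤ n) (p : unitInterval) (hp : (p : ℝ) ≤ 1 / 2) (M : ℕ)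
    (hM : 1 ≤ M) :
    (Real.exp (1024 * (n * (p : ℝ) ^ 3) + 2 * ((p : ℝ) ^ 2 * M)) * ((1 - p : ℝ) ^ 20)⁻¹ +
      256 * Real.exp (8 * (n * (p : ℝ) ^ 3)) * ((1 - p : ℝ) ^ 10)⁻¹ *
        (Real.exp (4 * (n * (p : ℝ) ^ 2)) / M))⁻¹ ≤
      (L.randomGraph p).real {Γ | 2 < Γ.ediam} := by
  refine le_trans ?_ (L.inv_le_randomGraph_two_lt_ediam hn p (by linarith) M hM)
  have hp0 : (0 : ℝ) ≤ p := p.2.1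
  have hp2 : (p : ℝ) ^ 2 ≤ 1 / 2 := by nlinarith
  have hp1 : (0 : ℝ) < 1 - p := by linarith
  have hM0 : (0 : ℝ) < M := by exact_mod_cast hM
  set a : ℝ := 1 - (p : ℝ) ^ 2 with ha
  have ha0 : 1 / 2 ≤ a := by rw [ha]; linarith
  have ha0' : 0 < a := by linarith
  have hb : 1 - 64 * (p : ℝ) ≤ (1 - p : ℝ) ^ 64 := by
    have := one_add_mul_le_pow (a := -(p : ℝ)) (by linarith) 64
    rw [← sub_eq_add_neg] at this
    push_cast at this
    linarith
  have hz : (1 - p : ℝ) ^ 64 ≤ 1 := pow_le_one₀ hp1.le (by linarith)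
  generalize (1 - p : ℝ) ^ 64 = z at hb hz ⊢
  set y : ℝ := 1 - (p : ℝ) ^ 2 * z with hy
  have hay : a ≤ y := by
    have := mul_le_mul_of_nonneg_left hz (sq_nonneg (p : ℝ))
    rw [ha, hy]; linarith
  have hy0 : 0 < y := by linarith
  have h1 : (y / a) ^ (8 * n) ≤ Real.exp (1024 * (n * (p : ℝ) ^ 3)) := by
    -- The two rates differ by only `p² (1 - z) ≤ 64 p³`, by Bernoulli's inequality, and `a ≥ 1 /
    -- 2`. Hence the loss over `8 n` factors is governed by `n p³`, which tends to zero.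
    have h2 : y / a ≤ Real.exp (128 * (p : ℝ) ^ 3) := by
      refine le_trans ?_ (Real.add_one_le_exp _)
      rw [div_le_iff₀ ha0']
      have h3 : y ≤ a + 64 * (p : ℝ) ^ 3 := by
        have := mul_le_mul_of_nonneg_left hb (sq_nonneg (p : ℝ))
        rw [ha, hy]; nlinarith
      have h4 : 0 ≤ (p : ℝ) ^ 3 * (a - 1 / 2) := mul_nonneg (pow_nonneg hp0 _) (by linarith)
      nlinarith
    refine (pow_le_pow_left₀ (by positivity) h2 _).trans (le_of_eq ?_)
    rw [← Real.exp_nat_mul]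
    congr 1; push_cast; ring
  have h5 : (y ^ M)⁻¹ ≤ Real.exp (2 * ((p : ℝ) ^ 2 * M)) := by
    refine inv_le_of_inv_le₀ (by positivity) ?_
    rw [← Real.exp_neg]
    refine le_trans ?_ (pow_le_pow_left₀ ha0'.le hay M)
    refine le_trans ?_ (one_sub_pow_ge_exp hp2 M)
    rw [Real.exp_le_exp]
    have : 0 ≤ (M : ℝ) * (p : ℝ) ^ 2 * (1 / 2 - (p : ℝ) ^ 2) :=
      mul_nonneg (by positivity) (by linarith)
    linear_combination 2 * this
  have h6 : (a ^ (4 * n))⁻¹ ≤ Real.exp (8 * (n * (p : ℝ) ^ 3)) *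
      Real.exp (4 * (n * (p : ℝ) ^ 2)) := by
    refine inv_le_of_inv_le₀ (by positivity) ?_
    rw [← Real.exp_add, ← Real.exp_neg]
    refine le_trans ?_ (one_sub_pow_ge_exp hp2 (4 * n))
    rw [Real.exp_le_exp]
    have : 0 ≤ (n : ℝ) * (p : ℝ) ^ 3 * (1 - p) := mul_nonneg (by positivity) (by linarith)
    push_cast
    linear_combination 8 * this
  refine inv_anti₀ ?_ (add_le_add ?_ ?_)
  · positivity
  · rw [Real.exp_add]
    gcongr
  · have : 256 / (M * (a ^ (4 * n) * (1 - p : ℝ) ^ 10)) =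
        256 * (a ^ (4 * n))⁻¹ * ((1 - p : ℝ) ^ 10)⁻¹ * (M : ℝ)⁻¹ := by
      field_simp
    rw [this]
    calc _ ≤ 256 * (Real.exp (8 * (n * (p : ℝ) ^ 3)) * Real.exp (4 * (n * (p : ℝ) ^ 2))) *
          ((1 - p : ℝ) ^ 10)⁻¹ * (M : ℝ)⁻¹ := by gcongr
      _ = _ := by ring

open Filter Topology in
theorem tendsto_two_lt_ediam {ε : ℝ} (hε : 0 < ε) (hε8 : ε ≤ 1 / 8)
    {n : ℕ → ℕ} (hn : Filter.Tendsto n Filter.atTop Filter.atTop)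
    {A : ℕ → Type*} [∀ k, Fintype (A k)] (L : ∀ k, LatinSquare (n k) (A k))
    (p : ℕ → unitInterval)
    (hp : ∀ᶠ k in Filter.atTop, (p k : ℝ) ≤ √((1 / 4 - ε) * (Real.log (n k) / (n k)))) :
    Filter.Tendsto (fun k => (L k).randomGraph (p k) {Γ | 2 < Γ.ediam})
      Filter.atTop (nhds 1) := by
  have hnR : Tendsto (fun k => (n k : ℝ)) atTop atTop := tendsto_natCast_atTop_atTop.comp hn
  have hlog3 : Tendsto (fun x : ℝ => Real.log x ^ 3 / x) atTop (𝓝 0) :=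
    (Real.isLittleO_pow_log_id_atTop (n := 3)).tendsto_div_nhds_zero
  have hlog1 : Tendsto (fun x : ℝ => Real.log x / x) atTop (𝓝 0) := by
    simpa using (Real.isLittleO_pow_log_id_atTop (n := 1)).tendsto_div_nhds_zero
  have hlogε : Tendsto (fun x : ℝ => Real.log x / x ^ (2 * ε)) atTop (𝓝 0) :=
    (isLittleO_log_rpow_atTop (by linarith : 0 < 2 * ε)).tendsto_div_nhds_zero
  have hpsq : ∀ᶠ k in atTop, (p k : ℝ) ^ 2 ≤ (1 / 4 - ε) * (Real.log (n k) / (n k)) := by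
    filter_upwards [hp, hn.eventually_ge_atTop 1] with k hk hnk
    have hN : (1 : ℝ) ≤ n k := by exact_mod_cast hnk
    refine (Real.le_sqrt (p k).2.1 (mul_nonneg (by linarith) ?_)).1 hk
    exact div_nonneg (Real.log_nonneg hN) (by linarith)
  -- `M` must be `o(n / log n)`, so that `p² M → 0`, yet dominate `exp (4 n p²) ≤ n ^ (1 - 4 ε)`;
  -- the exponent `1 - 2 ε` lies between.
  set M : ℕ → ℕ := fun k => ⌈(n k : ℝ) ^ (1 - 2 * ε)⌉₊ with hM
  have hp0 : Tendsto (fun k => (p k : ℝ)) atTop (𝓝 0) := by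
    have h := (hlog1.comp hnR).sqrt
    rw [Real.sqrt_zero] at h
    refine squeeze_zero' (Eventually.of_forall fun k => (p k).2.1) ?_ h
    filter_upwards [hpsq, hn.eventually_ge_atTop 1] with k hk hnk
    have hN : (1 : ℝ) ≤ n k := by exact_mod_cast hnk
    refine Real.le_sqrt_of_sq_le (hk.trans ?_)
    have : 0 ≤ Real.log (n k) / (n k) := div_nonneg (Real.log_nonneg hN) (by linarith)
    simp only [Function.comp]
    nlinarith
  have hT1 : Tendsto (fun k => (n k : ℝ) * (p k : ℝ) ^ 3) atTop (𝓝 0) := by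
    have h := (hlog3.comp hnR).sqrt
    rw [Real.sqrt_zero] at h
    refine squeeze_zero' (Eventually.of_forall fun k =>
      mul_nonneg (Nat.cast_nonneg _) (pow_nonneg (p k).2.1 _)) ?_ h
    filter_upwards [hpsq, hn.eventually_ge_atTop 1] with k hk hnk
    have hN : (1 : ℝ) ≤ n k := by exact_mod_cast hnk
    refine Real.le_sqrt_of_sq_le ?_
    have h0 : 0 ≤ Real.log (n k) / (n k) := div_nonneg (Real.log_nonneg hN) (by linarith)
    have h1 : (p k : ℝ) ^ 2 ≤ Real.log (n k) / (n k) := by nlinarith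
    calc ((n k : ℝ) * (p k : ℝ) ^ 3) ^ 2 = (n k : ℝ) ^ 2 * ((p k : ℝ) ^ 2) ^ 3 := by ring
      _ ≤ (n k : ℝ) ^ 2 * (Real.log (n k) / (n k)) ^ 3 := by gcongr
      _ = _ := by simp only [Function.comp]; field_simp
  have hT2 : Tendsto (fun k => (p k : ℝ) ^ 2 * M k) atTop (𝓝 0) := by
    have h := (hlogε.comp hnR).add (hlog1.comp hnR)
    rw [add_zero] at h
    refine squeeze_zero' (Eventually.of_forall fun k =>
      mul_nonneg (sq_nonneg _) (Nat.cast_nonneg _)) ?_ h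
    filter_upwards [hpsq, hn.eventually_ge_atTop 1] with k hk hnk
    have hN : (1 : ℝ) ≤ n k := by exact_mod_cast hnk
    have hN0 : (0 : ℝ) < n k := by linarith
    have h0 : 0 ≤ Real.log (n k) / (n k) := div_nonneg (Real.log_nonneg hN) (by linarith)
    have h1 : (p k : ℝ) ^ 2 ≤ Real.log (n k) / (n k) := by nlinarith
    have h2 : (M k : ℝ) ≤ (n k : ℝ) ^ (1 - 2 * ε) + 1 :=
      (Nat.ceil_lt_add_one (Real.rpow_nonneg hN0.le _)).le
    calc (p k : ℝ) ^ 2 * M k ≤ Real.log (n k) / (n k) * ((n k : ℝ) ^ (1 - 2 * ε) + 1) := by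
          gcongr
      _ = _ := by
          simp only [Function.comp]
          rw [Real.rpow_sub hN0, Real.rpow_one]
          field_simp
  have hT3 : Tendsto (fun k => Real.exp (4 * ((n k : ℝ) * (p k : ℝ) ^ 2)) / M k) atTop (𝓝 0) := by
    have h := (tendsto_rpow_neg_atTop (by linarith : 0 < 2 * ε)).comp hnR
    refine squeeze_zero' (Eventually.of_forall fun k =>
      div_nonneg (Real.exp_nonneg _) (Nat.cast_nonneg _)) ?_ h
    filter_upwards [hpsq, hn.eventually_ge_atTop 1] with k hk hnk
    have hN : (1 : ℝ) ≤ n k := by exact_mod_cast hnk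
    have hN0 : (0 : ℝ) < n k := by linarith
    have h1 : Real.exp (4 * ((n k : ℝ) * (p k : ℝ) ^ 2)) ≤ (n k : ℝ) ^ (1 - 4 * ε) := by
      rw [Real.rpow_def_of_pos hN0, Real.exp_le_exp]
      have h2 := mul_le_mul_of_nonneg_left hk hN0.le
      have h3 : (n k : ℝ) * ((1 / 4 - ε) * (Real.log (n k) / (n k))) =
          (1 / 4 - ε) * Real.log (n k) := by field_simp
      linarith
    have h4 : (n k : ℝ) ^ (1 - 2 * ε) ≤ M k := Nat.le_ceil _
    calc _ ≤ (n k : ℝ) ^ (1 - 4 * ε) / (n k : ℝ) ^ (1 - 2 * ε) := by gcongr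
      _ = _ := by
          rw [← Real.rpow_sub hN0]
          simp only [Function.comp]
          congr 1; ring
  have hq : ∀ d : ℕ, Tendsto (fun k => ((1 - p k : ℝ) ^ d)⁻¹) atTop (𝓝 1) := fun d => by
    have := ((tendsto_const_nhds (x := (1 : ℝ))).sub hp0).pow d
    simpa using this.inv₀ (by simp)
  have hE1 : Tendsto (fun k => Real.exp (1024 * ((n k : ℝ) * (p k : ℝ) ^ 3) +
      2 * ((p k : ℝ) ^ 2 * M k))) atTop (𝓝 1) := by
    have := ((hT1.const_mul 1024).add (hT2.const_mul 2)).rexp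
    simpa using this
  have hE2 : Tendsto (fun k => Real.exp (8 * ((n k : ℝ) * (p k : ℝ) ^ 3))) atTop (𝓝 1) := by
    have := (hT1.const_mul 8).rexp
    simpa using this
  have hlim := (((hE1.mul (hq 20)).add (((hE2.const_mul 256).mul (hq 10)).mul hT3))).inv₀ (by simp)
  refine tendsto_measure_one_of_real _ _ (by simpa using hlim) ?_
  filter_upwards [hn.eventually_ge_atTop 4, hp0.eventually_le_const (by norm_num : (0 : ℝ) < 1 / 2)]
    with k hnk hpk
  have hN0 : (0 : ℝ) < n k := by exact_mod_cast (by omega : 0 < n k)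
  exact (L k).exp_inv_le_randomGraph_two_lt_ediam hnk (p k) hpk (M k)
    (Nat.ceil_pos.2 (Real.rpow_pos_of_pos hN0 _))

end LatinSquare

theorem theorem7 (ε : ℝ) (hε : 0 < ε)
    (n : ℕ → ℕ) (hn : Filter.Tendsto n Filter.atTop Filter.atTop)
    (A : ℕ → Type*) [∀ k, Fintype (A k)] (L : ∀ k, LatinSquare (n k) (A k))
    (p : ℕ → unitInterval) :
    ((∀ᶠ k in Filter.atTop, √((26 + ε) * (Real.log (n k) / (n k))) ≤ (p k : ℝ)) →
      Filter.Tendsto (fun k => (L k).randomGraph (p k) {Γ | Γ.ediam ≤ 2})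
        Filter.atTop (nhds 1)) ∧
    ((∀ᶠ k in Filter.atTop, (p k : ℝ) ≤ √((1 / 4 - ε) * (Real.log (n k) / (n k)))) →
      Filter.Tendsto (fun k => (L k).randomGraph (p k) {Γ | 2 < Γ.ediam})
        Filter.atTop (nhds 1)) := by
  -- Shrinking `ε` to at most `1 / 8` weakens the hypothesis on `p` and keeps `1 / 4 - ε` positive,
  -- so that the bound can be squared; a negative radicand is thereby absorbed.
  refine ⟨LatinSquare.tendsto_ediam_le_two hε hn L p, fun hp =>
    LatinSquare.tendsto_two_lt_ediam (lt_min hε (by norm_num : (0 : ℝ) < 1 / 8))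
      (min_le_right _ _) hn L p ?_⟩
  filter_upwards [hp, hn.eventually_ge_atTop 1] with k hk hnk
  have hN : (1 : ℝ) ≤ n k := by exact_mod_cast hnk
  refine hk.trans (Real.sqrt_le_sqrt (mul_le_mul_of_nonneg_right ?_ ?_))
  · linarith [min_le_left ε (1 / 8)]
  · exact div_nonneg (Real.log_nonneg hN) (by linarith)
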